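/- **Lemma (no UPB of size 18, 19, 20 in $\mathbb{C}^5\otimes\mathbb{C}^5$).** A *product state* is a nonzero vector $a\otimes b$. An *unextendible product basis* (UPB) of $\mathbb{C}^m\otimes\mathbb{C}^n$ is a set of pairwise orthogonal product states that does not span the space and whose orthogonal complement contains no product state. The *Tiles UPB* of $\mathbb{C}^3\otimes\mathbb{C}^3$ consists, up to normalization, of the five states $$|0\rangle|0-1\rangle,\quad |2\rangle|1-2\rangle,\quad |0-1\rangle|2\rangle,\quad |1-2\rangle|0\rangle,\quad |0+1+2\rangle|0+1+2\rangle,$$ where $|i\pm j\rangle=|i\rangle\pm|j\rangle$ and $|0+1+2\rangle=|0\rangle+|1\rangle+|2\rangle$. A set $\mathcal U\subset\mathbb{C}^5\otimes\mathbb{C}^5$ *preserves the tile structure* of the Tiles UPB if there are isometries $V,W:\mathbb{C}^3\to\mathbb{C}^5$ (for instance $V=W:|i\rangle\mapsto|i+1\rangle$, which gives the central $3\times3$ block) such that for every $u\in\mathcal U$ the vector $(V^\dagger\otimes W^\dagger)u$ is a scalar multiple (possibly zero) of one of these five states. If a UPB $\mathcal U$ of $\mathbb{C}^5\otimes\mathbb{C}^5$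 preserves the tile structure of the Tiles UPB of $\mathbb{C}^3\otimes\mathbb{C}^3$, then the number of its members is none of $18$, $19$, $20$. -/

import Mathlib

open scoped TensorProduct

/-- A pure product state (not necessarily normalized): a nonzero simple tensor. -/
def IsProductState {H K : Type*} [AddCommGroup H] [Module ℂ H] [AddCommGroup K] [Module ℂ K]
    (x : H ⊗[ℂ] K) : Prop :=
  ∃ a : H, ∃ b : K, a ≠ 0 ∧ b ≠ 0 ∧ x = a ⊗ₜ[ℂ] b

/-- An unextendible product basis of the bipartite space `H ⊗ K`: a set of pairwise orthogonal
product states that does not span the whole space and whose orthogonal complement contains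
no product state. -/
structure IsUPB {H K : Type*} [NormedAddCommGroup H] [InnerProductSpace ℂ H]
    [NormedAddCommGroup K] [InnerProductSpace ℂ K] (S : Set (H ⊗[ℂ] K)) : Prop where
  isProductState : ∀ x ∈ S, IsProductState x
  orthogonal : S.Pairwise fun x y => inner ℂ x y = 0
  incomplete : Submodule.span ℂ S ≠ ⊤
  unextendible : ∀ x ∈ (Submodule.span ℂ S)ᗮ, ¬ IsProductState x

/-- The computational basis vector `|i⟩` of `ℂᵈ`. -/
noncomputable def ket {d : ℕ} (i : Fin d) : EuclideanSpace ℂ (Fin d) :=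
  EuclideanSpace.single i 1

/-- The (unnormalized) Tiles UPB of `ℂ³ ⊗ ℂ³`: one state on each of the four tiles surrounding
the central one, and the stopper. -/
noncomputable def tilesUPB : Set (EuclideanSpace ℂ (Fin 3) ⊗[ℂ] EuclideanSpace ℂ (Fin 3)) :=
  { ket 0 ⊗ₜ (ket 0 - ket 1),
    ket 2 ⊗ₜ (ket 1 - ket 2),
    (ket 0 - ket 1) ⊗ₜ ket 2,
    (ket 1 - ket 2) ⊗ₜ ket 0,
    (ket 0 + ket 1 + ket 2) ⊗ₜ (ket 0 + ket 1 + ket 2) }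

/-- The compression `V† ⊗ W†` of `ℂ⁵ ⊗ ℂ⁵` to the two-qutrit block given by the isometries
`V, W : ℂ³ → ℂ⁵`. For `V = W = (|i⟩ ↦ |i+1⟩)` the block is the central `3 × 3` block, spanned
by the `|i⟩|j⟩` with `1 ≤ i, j ≤ 3`. -/
noncomputable def compressToBlock
    (V W : EuclideanSpace ℂ (Fin 3) →ₗᵢ[ℂ] EuclideanSpace ℂ (Fin 5)) :
    EuclideanSpace ℂ (Fin 5) ⊗[ℂ] EuclideanSpace ℂ (Fin 5) →ₗ[ℂ]
      EuclideanSpace ℂ (Fin 3) ⊗[ℂ] EuclideanSpace ℂ (Fin 3) :=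
  TensorProduct.map (LinearMap.adjoint V.toLinearMap) (LinearMap.adjoint W.toLinearMap)

/-- A set of vectors of `ℂ⁵ ⊗ ℂ⁵` preserves the tile structure of the Tiles UPB of `ℂ³ ⊗ ℂ³` if
on some two-qutrit block it looks like the Tiles UPB: the component of every member in the block
vanishes or is proportional to one of the five Tiles states. -/
def PreservesTiles
    (S : Set (EuclideanSpace ℂ (Fin 5) ⊗[ℂ] EuclideanSpace ℂ (Fin 5))) : Prop :=
  ∃ V W : EuclideanSpace ℂ (Fin 3) →ₗᵢ[ℂ] EuclideanSpace ℂ (Fin 5),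
    ∀ x ∈ S, ∃ c : ℂ, ∃ t ∈ tilesUPB, compressToBlock V W x = c • t

/-! Let `R` be the space orthogonal to the members of `S` and to the 4-dimensional part of the block
orthogonal to all tiles. The members are orthogonal to that part because they compress to multiples
of tiles, so `R` has dimension 25 - 4 - |S|, that is 3, 2 or 1 in the excluded cases. The projection
onto `R` is the identity, minus the block projection, plus the tile projections, minus the member
projections. Each term is a product operator, so the partial transpose is again such a projection,
built from data conjugated in the second factor (`IsTiled.conj`). Hence the projection onto `R` has
a positive partial transpose.

A nonzero projection of rank at most three with this property has a product vector in its range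
(`HasPPT.exists_zeroMinors`, `isProductState_of_zeroMinors`), which contradicts unextendibility. To
find it, put `v e f` for the projection of `e ⊗ f`. If some slice `v e` or `v.flip f` is onto `R`,
the other slices act on `R` with a common eigenvector; if none is, slices have rank at most two and
a dimension count suffices. -/

/-! ### Rank-one forms and common eigenvectors. -/

/-- A scalar-valued function of two variables of rank at most one: all its `2 × 2` minors vanish. -/
def HasZeroMinors {A B : Type*} (L : A → B → ℂ) : Prop :=
  ∀ e e' f f', L e f * L e' f' = L e f' * L e' f

theorem HasZeroMinors.swap {A B : Type*} {L : A → B → ℂ} (h : HasZeroMinors L) :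
    HasZeroMinors fun f e => L e f := by
  intro f f' e e'
  linear_combination h e e' f f'

/-- A family of endomorphisms in which the kernel of every shifted member is stable under all
members has a common eigenvector. -/
theorem exists_common_eigenvector {A R : Type*} [AddCommGroup R] [Module ℂ R]
    [FiniteDimensional ℂ R] [Nontrivial R] (C : A → Module.End ℂ R)
    (hC : ∀ a a' : A, ∀ l : ℂ, ∀ p, C a p = l • p → C a (C a' p) = l • C a' p) :
    ∃ w : R, w ≠ 0 ∧ ∀ a, ∃ l : ℂ, C a w = l • w := by
  -- In a minimal nonzero invariant subspace, each eigenspace of a member is itself invariant, hence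
  -- everything.
  let good : Set (Submodule ℂ R) := {U | U ≠ ⊥ ∧ ∀ a, ∀ u ∈ U, C a u ∈ U}
  have hgood : good.Nonempty := ⟨⊤, top_ne_bot, fun _ _ _ => trivial⟩
  obtain ⟨U, ⟨hU0, hU⟩, hmin⟩ := WellFounded.has_min
    (IsWellFounded.wf : WellFounded fun U U' : Submodule ℂ R => U < U') good hgood
  obtain ⟨w, hwU, hw0⟩ := Submodule.exists_mem_ne_zero_of_ne_bot hU0
  refine ⟨w, hw0, fun a => ?_⟩
  have : Nontrivial U := Submodule.nontrivial_iff_ne_bot.2 hU0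
  obtain ⟨l, hl⟩ := Module.End.exists_eigenvalue ((C a).restrict (hU a))
  obtain ⟨x, hx⟩ := hl.exists_hasEigenvector
  have hx1 : C a x = l • (x : R) := congrArg Subtype.val hx.apply_eq_smul
  have hx0 : (x : R) ≠ 0 := fun h => hx.2 (Subtype.ext h)
  let U' : Submodule ℂ R := U ⊓ LinearMap.ker (C a - l • LinearMap.id)
  have hmem : ∀ u, u ∈ U' ↔ u ∈ U ∧ C a u = l • u := by
    intro u; simp [U', sub_eq_zero]
  have hU' : U' ∈ good := by
    refine ⟨fun h => hx0 ?_, fun a' u hu => ?_⟩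
    · have : (x : R) ∈ U' := (hmem _).2 ⟨x.2, hx1⟩
      simpa [h] using this
    · rw [hmem] at hu ⊢
      exact ⟨hU a' u hu.1, hC a a' l u hu.2⟩
  have hle : U' ≤ U := inf_le_left
  have heq : U' = U := by
    by_contra hne
    exact hmin U' hU' (lt_of_le_of_ne hle hne)
  exact ⟨l, ((hmem w).1 (heq ▸ hwU)).2⟩

/-! ### Bilinear maps with positive partial transpose. -/

section PositivePartialTranspose

variable {A B R : Type*} [AddCommGroup A] [Module ℂ A] [AddCommGroup B] [Module ℂ B]
  [NormedAddCommGroup R] [InnerProductSpace ℂ R]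

/-- A bilinear map `v` into an inner product space such that the form
`⟨v e f, v e' f'⟩` of `e ⊗ f` and `e' ⊗ f'` has, in effect, a positive partial transpose. -/
def HasPPT (v : A →ₗ[ℂ] B →ₗ[ℂ] R) : Prop :=
  ∀ e e' f f', ‖inner ℂ (v e f') (v e' f)‖ ≤ ‖v e f‖ * ‖v e' f'‖

theorem HasPPT.flip {v : A →ₗ[ℂ] B →ₗ[ℂ] R} (hv : HasPPT v) : HasPPT v.flip := by
  intro f f' e e'
  have h := hv e e' f f'
  rw [norm_inner_symm] at h
  simpa using h

/-- Apart from its symmetry, positivity is used below only through this degenerate case. -/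
theorem HasPPT.inner_eq_zero {v : A →ₗ[ℂ] B →ₗ[ℂ] R} (hv : HasPPT v) {e : A} {f : B}
    (h : v e f = 0) (e' : A) (f' : B) : inner ℂ (v e f') (v e' f) = 0 := by
  have := hv e e' f f'
  rw [h, norm_zero, zero_mul] at this
  exact norm_le_zero_iff.1 this

/-- Zeros of `v e` are zeros of every `v a`, so `v a` factors through `v e` by an endomorphism `C a
= v a ∘ s` of `R`. Orthogonality at zeros makes the kernel of `C a - l` the complement of its range,
and stable under every `C a'`. Pairing with a common eigenvector `w` splits the form as `l a * ⟨w, v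
e b⟩`. -/
theorem HasPPT.exists_zeroMinors_of_surjective [FiniteDimensional ℂ R] [Nontrivial R]
    {v : A →ₗ[ℂ] B →ₗ[ℂ] R} (hv : HasPPT v) {e : A} (he : Function.Surjective (v e)) :
    ∃ w : R, w ≠ 0 ∧ HasZeroMinors fun a b => inner ℂ w (v a b) := by
  obtain ⟨s, hs⟩ := (v e).exists_rightInverse_of_surjective (LinearMap.range_eq_top.2 he)
  have hs' : ∀ p, v e (s p) = p := fun p => LinearMap.congr_fun hs p
  have hfac : ∀ a f, v a f = v a (s (v e f)) := by
    intro a f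
    have h0 : v e (f - s (v e f)) = 0 := by rw [map_sub, hs', sub_self]
    obtain ⟨g, hg⟩ := he (v a (f - s (v e f)))
    have h1 := hv.inner_eq_zero h0 a g
    rw [hg, inner_self_eq_zero, map_sub, sub_eq_zero] at h1
    exact h1
  have key : ∀ (a a' : A) (l : ℂ) (p q : R), v a (s p) = l • p →
      inner ℂ (v a (s q) - l • q) (v a' (s p)) = 0 := by
    intro a a' l p q h
    -- An eigenvector of `v a ∘ s` is the same as a zero of `v` at a shifted first argument.
    have h0 : v (a - l • e) (s p) = 0 := by simp [h, hs']
    have h1 := hv.inner_eq_zero h0 a' (s q)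
    simpa [hs'] using h1
  have stab : ∀ (a a' : A) (l : ℂ) (p : R), v a (s p) = l • p →
      v a (s (v a' (s p))) = l • v a' (s p) := by
    intro a a' l p h
    let D : Module.End ℂ R := v a ∘ₗ s - l • LinearMap.id
    have hD : ∀ x, D x = v a (s x) - l • x := fun x => by simp [D]
    have hle : LinearMap.ker D ≤ (LinearMap.range D)ᗮ := by
      intro x hx
      rw [LinearMap.mem_ker, hD, sub_eq_zero] at hx
      rw [Submodule.mem_orthogonal]
      rintro _ ⟨q, rfl⟩
      have h1 := key a e l x q hx
      rw [hs'] at h1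
      rwa [hD]
    have heq : LinearMap.ker D = (LinearMap.range D)ᗮ := by
      apply Submodule.eq_of_le_of_finrank_eq hle
      have h1 := LinearMap.finrank_range_add_finrank_ker D
      have h2 := (LinearMap.range D).finrank_add_finrank_orthogonal
      omega
    have hm : v a' (s p) ∈ LinearMap.ker D := by
      rw [heq, Submodule.mem_orthogonal]
      rintro _ ⟨q, rfl⟩
      rw [hD]
      exact key a a' l p q h
    rwa [LinearMap.mem_ker, hD, sub_eq_zero] at hm
  obtain ⟨w, hw0, hw⟩ := exists_common_eigenvector (fun a => v a ∘ₗ s) stab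
  refine ⟨w, hw0, ?_⟩
  choose l hl using hw
  have hform : ∀ a b, inner ℂ w (v a b) = l a * inner ℂ w (v e b) := by
    intro a b
    have h := key a e (l a) w (v e b) (hl a)
    rw [hs', ← hfac, ← inner_conj_symm, map_eq_zero, inner_sub_right, inner_smul_right,
      sub_eq_zero] at h
    exact h
  intro a a' b b'
  simp only [hform a, hform a']
  ring

/-- A slice `v e` of maximal rank works. If `v e f = 0` but `v e' f ≠ 0`, then `v e' f` is
orthogonal to the range of `v e`, and a small perturbation `e + t • e'` would have larger rank. -/
theorem HasPPT.exists_ker_le [FiniteDimensional ℂ R]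
    {v : A →ₗ[ℂ] B →ₗ[ℂ] R} (hv : HasPPT v) :
    ∃ e, ∀ f, v e f = 0 → ∀ e', v e' f = 0 := by
  let g : A → ℕ := fun e => Module.finrank ℂ (LinearMap.range (v e))
  have hbdd : BddAbove (Set.range g) := by
    refine ⟨Module.finrank ℂ R, ?_⟩
    rintro _ ⟨e, rfl⟩
    exact Submodule.finrank_le _
  obtain ⟨e, he⟩ := Nat.sSup_mem (Set.range_nonempty g) hbdd
  have hmax : ∀ e', g e' ≤ g e := fun e' => he ▸ le_csSup hbdd ⟨e', rfl⟩
  refine ⟨e, fun f hf e' => ?_⟩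
  by_contra hz
  let b := Module.finBasis ℂ (LinearMap.range (v e))
  have hx : ∀ i, ∃ x, v e x = (b i : R) := fun i => (b i).2
  choose x hx using hx
  let fam : ℂ → Fin (g e + 1) → R := fun t =>
    Fin.cons (v e' f) fun i => v e (x i) + t • v e' (x i)
  have hcont : Continuous fam := by
    refine continuous_pi fun i => ?_
    refine Fin.cases ?_ (fun i => ?_) i
    · simp only [fam, Fin.cons_zero]; fun_prop
    · simp only [fam, Fin.cons_succ]; fun_prop
  have hli : LinearIndependent ℂ (fam 0) := by
    refine LinearIndependent.finCons ?_ ?_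
    · have h := b.linearIndependent.map' (LinearMap.range (v e)).subtype (Submodule.ker_subtype _)
      have hfun : (fun i => v e (x i) + (0 : ℂ) • v e' (x i)) =
          (LinearMap.range (v e)).subtype ∘ b := by
        funext i; simp [hx]
      rw [hfun]
      exact h
    · intro hmem
      have hsub : Submodule.span ℂ (Set.range fun i => v e (x i) + (0 : ℂ) • v e' (x i)) ≤
          LinearMap.range (v e) := by
        rw [Submodule.span_le]
        rintro _ ⟨i, rfl⟩
        exact ⟨x i, by simp⟩
      obtain ⟨y, hy⟩ := hsub hmem
      have := hv.inner_eq_zero hf e' y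
      rw [hy, inner_self_eq_zero] at this
      exact hz this
  have hev : ∀ᶠ t in nhdsWithin (0 : ℂ) {0}ᶜ, LinearIndependent ℂ (fam t) :=
    (hcont.tendsto 0).mono_left nhdsWithin_le_nhds
      |>.eventually (isOpen_setOfPred_linearIndependent.mem_nhds hli)
  obtain ⟨t, hlit, ht⟩ := (hev.and self_mem_nhdsWithin).exists
  have ht0 : t ≠ 0 := ht
  have hle : Submodule.span ℂ (Set.range (fam t)) ≤ LinearMap.range (v (e + t • e')) := by
    rw [Submodule.span_le]
    rintro _ ⟨i, rfl⟩
    refine Fin.cases ?_ (fun i => ?_) i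
    -- As `v e f = 0`, the perturbed slice sends `t⁻¹ • f` exactly to `v e' f`.
    · exact ⟨t⁻¹ • f, by simp [fam, hf, ht0]⟩
    · exact ⟨x i, by simp [fam]⟩
  have h1 := Submodule.finrank_mono hle
  rw [finrank_span_eq_card hlit, Fintype.card_fin] at h1
  have h2 := hmax (e + t • e')
  simp only [g] at h1 h2
  omega

theorem exists_ne_zero_inner_range_eq_zero [FiniteDimensional ℂ R] {T : B →ₗ[ℂ] R}
    (hT : ¬ Function.Surjective T) : ∃ w : R, w ≠ 0 ∧ ∀ b, inner ℂ w (T b) = 0 := by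
  have h : (LinearMap.range T)ᗮ ≠ ⊥ := by
    rw [Ne, Submodule.orthogonal_eq_bot_iff, LinearMap.range_eq_top]
    exact hT
  obtain ⟨w, hw, hw0⟩ := Submodule.exists_mem_ne_zero_of_ne_bot h
  exact ⟨w, hw0, fun b => (Submodule.mem_orthogonal' _ _).1 hw _ ⟨b, rfl⟩⟩

theorem HasPPT.exists_zeroMinors [FiniteDimensional ℂ R] [Nontrivial R]
    (hR : Module.finrank ℂ R ≤ 3) {v : A →ₗ[ℂ] B →ₗ[ℂ] R} (hv : HasPPT v) :
    ∃ w : R, w ≠ 0 ∧ HasZeroMinors fun a b => inner ℂ w (v a b) := by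
  by_cases h1 : ∃ e, Function.Surjective (v e)
  · obtain ⟨e, he⟩ := h1
    exact hv.exists_zeroMinors_of_surjective he
  by_cases h2 : ∃ f, Function.Surjective (v.flip f)
  · obtain ⟨f, hf⟩ := h2
    obtain ⟨w, hw0, hw⟩ := hv.flip.exists_zeroMinors_of_surjective hf
    exact ⟨w, hw0, hw.swap⟩
  push Not at h1 h2
  obtain ⟨f, hf⟩ := hv.flip.exists_ker_le
  simp only [LinearMap.flip_apply] at hf
  have hrank : Module.finrank ℂ (LinearMap.range (v.flip f)) ≤ 2 := by
    have h : LinearMap.range (v.flip f) < ⊤ := by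
      rw [lt_top_iff_ne_top, Ne, LinearMap.range_eq_top]; exact h2 f
    have := Submodule.finrank_lt h.ne
    omega
  by_cases h3 : ∀ e, v e f = 0
  · obtain ⟨w, hw⟩ := exists_ne (0 : R)
    refine ⟨w, hw, fun e e' b b' => ?_⟩
    simp [hf e (h3 e), hf e' (h3 e')]
  push Not at h3
  obtain ⟨e₁, he₁⟩ := h3
  obtain ⟨w, hw0, hw⟩ := exists_ne_zero_inner_range_eq_zero (h1 e₁)
  refine ⟨w, hw0, fun e e' b b' => ?_⟩
  -- Three values of a slice of rank at most two are dependent. The relation spreads from `f` to all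
  -- arguments, and `w` removes the `e₁` term, leaving proportional rows.
  have hdep : ¬ LinearIndependent ℂ
      (fun i => (v.flip f).rangeRestrict ((![e, e', e₁] : Fin 3 → A) i)) := by
    intro h
    have := h.fintype_card_le_finrank
    simp at this
    omega
  rw [Fintype.not_linearIndependent_iff] at hdep
  obtain ⟨c, hc, hc0⟩ := hdep
  have hker : v (c 0 • e + c 1 • e' + c 2 • e₁) f = 0 := by
    have := congrArg Subtype.val hc
    simpa [Fin.sum_univ_three] using this
  have hall := hf _ hker
  have hL : ∀ g, c 0 * inner ℂ w (v e g) + c 1 * inner ℂ w (v e' g) = 0 := by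
    intro g
    have := congrArg (inner ℂ w) (hall g)
    simpa [inner_add_right, inner_smul_right, hw] using this
  have hb := hL b
  have hb' := hL b'
  by_cases hx : c 0 = 0
  · by_cases hy : c 1 = 0
    · exfalso
      have hz : c 2 = 0 := by simpa [hx, hy, he₁] using hker
      obtain ⟨i, hi⟩ := hc0
      fin_cases i <;> simp_all
    · have h : inner ℂ w (v e' b) = 0 ∧ inner ℂ w (v e' b') = 0 := by
        simpa [hx, hy] using And.intro hb hb'
      simp [h.1, h.2]
  · apply mul_left_cancel₀ hx
    linear_combination inner ℂ w (v e' b') * hb - inner ℂ w (v e' b) * hb'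

end PositivePartialTranspose

/-! ### Product vectors as rank-one functionals. -/

theorem exists_inner_eq {E : Type*} [NormedAddCommGroup E] [InnerProductSpace ℂ E]
    [FiniteDimensional ℂ E] (φ : E →ₗ[ℂ] ℂ) : ∃ x : E, ∀ y, inner ℂ x y = φ y := by
  have : CompleteSpace E := FiniteDimensional.complete ℂ E
  exact ⟨(InnerProductSpace.toDual ℂ E).symm (LinearMap.toContinuousLinearMap φ), fun y => by simp⟩

section Products

variable {H K : Type*} [NormedAddCommGroup H] [InnerProductSpace ℂ H] [FiniteDimensional ℂ H]
  [NormedAddCommGroup K] [InnerProductSpace ℂ K] [FiniteDimensional ℂ K]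

/-- Pivoting at a nonzero entry `(e₀, f₀)` factors the form as its column there times its row,
divided by the pivot; Riesz representation turns the two factors into vectors. -/
theorem isProductState_of_zeroMinors {w : H ⊗[ℂ] K} (hw : w ≠ 0)
    (h : HasZeroMinors fun (e : H) (f : K) => inner ℂ w (e ⊗ₜ[ℂ] f)) : IsProductState w := by
  obtain ⟨e₀, f₀, hc⟩ : ∃ e f, inner ℂ w (e ⊗ₜ[ℂ] f) ≠ 0 := by
    by_contra! h0
    exact hw (TensorProduct.ext_iff_inner_right.2 fun a b => by rw [h0 a b, inner_zero_left])
  obtain ⟨a, ha⟩ := exists_inner_eq ((inner ℂ w (e₀ ⊗ₜ[ℂ] f₀))⁻¹ •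
    (innerₛₗ ℂ w) ∘ₗ (TensorProduct.mk ℂ H K).flip f₀)
  obtain ⟨b, hb⟩ := exists_inner_eq ((innerₛₗ ℂ w) ∘ₗ TensorProduct.mk ℂ H K e₀)
  have hab : w = a ⊗ₜ[ℂ] b := by
    refine TensorProduct.ext_iff_inner_right.2 fun e f => ?_
    rw [TensorProduct.inner_tmul, ha, hb]
    have := h e e₀ f f₀
    simp only [LinearMap.smul_apply, LinearMap.comp_apply, LinearMap.flip_apply,
      TensorProduct.mk_apply, innerₛₗ_apply_apply, smul_eq_mul] at this ⊢
    field_simp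
    linear_combination this
  refine ⟨a, b, ?_, ?_, hab⟩
  · rintro rfl
    exact hw (by rw [hab, TensorProduct.zero_tmul])
  · rintro rfl
    exact hw (by rw [hab, TensorProduct.tmul_zero])

/-- The bilinear map sending `(e, f)` to the orthogonal projection of `e ⊗ f`. -/
noncomputable def projectTmul (R : Submodule ℂ (H ⊗[ℂ] K)) : H →ₗ[ℂ] K →ₗ[ℂ] R :=
  LinearMap.mk₂ ℂ (fun e f => R.orthogonalProjectionOnto (e ⊗ₜ[ℂ] f))
    (fun e e' f => by rw [TensorProduct.add_tmul, map_add])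
    (fun c e f => by rw [← TensorProduct.smul_tmul', map_smul])
    (fun e f f' => by rw [TensorProduct.tmul_add, map_add])
    (fun c e f => by rw [TensorProduct.tmul_smul, map_smul])

/-- A nonzero subspace of dimension at most three whose orthogonal projection has a positive
partial transpose contains a product state. -/
theorem exists_isProductState_mem (R : Submodule ℂ (H ⊗[ℂ] K)) [Nontrivial R]
    (hR : Module.finrank ℂ R ≤ 3)
    (hP : ∀ (e e' : H) (f f' : K), ‖inner ℂ (R.orthogonalProjectionOnto (e ⊗ₜ[ℂ] f'))
      (R.orthogonalProjectionOnto (e' ⊗ₜ[ℂ] f))‖ ≤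
      ‖R.orthogonalProjectionOnto (e ⊗ₜ[ℂ] f)‖ * ‖R.orthogonalProjectionOnto (e' ⊗ₜ[ℂ] f')‖) :
    ∃ w ∈ R, IsProductState w := by
  have hPPT : HasPPT (A := H) (B := K) (R := R) (projectTmul R) := hP
  obtain ⟨w, hw0, hw⟩ := hPPT.exists_zeroMinors hR
  refine ⟨w, w.2, isProductState_of_zeroMinors (fun h => hw0 (Subtype.ext h)) ?_⟩
  intro e e' f f'
  simpa [projectTmul] using hw e e' f f'

end Products

/-! ### The space `R`, its dimension and its projection. -/

section BlockComplement

variable {E F ι κ : Type*} [NormedAddCommGroup E] [InnerProductSpace ℂ E] [FiniteDimensional ℂ E]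
  [NormedAddCommGroup F] [InnerProductSpace ℂ F] [FiniteDimensional ℂ F]
  [Fintype ι] [Fintype κ]

/-- The orthogonal complement of the vectors `u` together with the part of the block `J` that is
orthogonal to the vectors `τ` of the block. -/
noncomputable def blockComplement (J : F →ₗᵢ[ℂ] E) (τ : κ → F) (u : ι → E) : Submodule ℂ E :=
  ((Submodule.span ℂ (Set.range τ))ᗮ.map J.toLinearMap ⊔ Submodule.span ℂ (Set.range u))ᗮ

theorem mem_orthogonal_span_range {G α : Type*} [NormedAddCommGroup G] [InnerProductSpace ℂ G]
    {τ : α → G} {x : G} :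
    x ∈ (Submodule.span ℂ (Set.range τ))ᗮ ↔ ∀ t, inner ℂ (τ t) x = 0 := by
  rw [Submodule.mem_orthogonal]
  refine ⟨fun h t => h _ (Submodule.subset_span ⟨t, rfl⟩), fun h y hy => ?_⟩
  induction hy using Submodule.span_induction with
  | mem y hy => obtain ⟨t, rfl⟩ := hy; exact h t
  | zero => exact inner_zero_left _
  | add y z _ _ hy hz => rw [inner_add_left, hy, hz, add_zero]
  | smul c y _ hy => rw [inner_smul_left, hy, mul_zero]

variable {J : F →ₗᵢ[ℂ] E} {τ : κ → F} {u : ι → E}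

omit [FiniteDimensional ℂ E] [FiniteDimensional ℂ F] [Fintype ι] [Fintype κ] in
theorem mem_blockComplement {x : E} : x ∈ blockComplement J τ u ↔
    (∀ y ∈ (Submodule.span ℂ (Set.range τ))ᗮ, inner ℂ (J y) x = 0) ∧
      ∀ i, inner ℂ (u i) x = 0 := by
  rw [blockComplement, ← Submodule.inf_orthogonal, Submodule.mem_inf, mem_orthogonal_span_range,
    Submodule.mem_orthogonal]
  simp

omit [Fintype ι] [Fintype κ] in
theorem inner_isometry_of_orthogonal
    (hJ : ∀ i, J.toLinearMap.adjoint (u i) ∈ Submodule.span ℂ (Set.range τ)) {y : F}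
    (hy : y ∈ (Submodule.span ℂ (Set.range τ))ᗮ) (i : ι) : inner ℂ (J y) (u i) = 0 := by
  have h := (Submodule.mem_orthogonal' _ _).1 hy _ (hJ i)
  rwa [LinearMap.adjoint_inner_right] at h

theorem finrank_blockComplement (hτ : Orthonormal ℂ τ) (hu : Orthonormal ℂ u)
    (hJ : ∀ i, J.toLinearMap.adjoint (u i) ∈ Submodule.span ℂ (Set.range τ)) :
    Module.finrank ℂ (blockComplement J τ u) + Module.finrank ℂ F + Fintype.card ι =
      Module.finrank ℂ E + Fintype.card κ := by
  set T := (Submodule.span ℂ (Set.range τ))ᗮ.map J.toLinearMap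
  set U := Submodule.span ℂ (Set.range u) with hU
  have h1 := (T ⊔ U).finrank_add_finrank_orthogonal
  have h2 := Submodule.finrank_sup_add_finrank_inf_eq T U
  have hdisj : T ⊓ U = ⊥ := by
    have hTU : T ≤ Uᗮ := by
      rintro _ ⟨y, hy, rfl⟩
      rw [hU, mem_orthogonal_span_range]
      intro i
      exact inner_eq_zero_symm.1 (inner_isometry_of_orthogonal hJ hy i)
    rw [eq_bot_iff, ← Submodule.inf_orthogonal_eq_bot U, inf_comm U]
    exact inf_le_inf_right _ hTU
  have h3 : Module.finrank ℂ T = Module.finrank ℂ (Submodule.span ℂ (Set.range τ))ᗮ :=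
    (Submodule.equivMapOfInjective J.toLinearMap J.injective _).symm.finrank_eq
  have h4 := (Submodule.span ℂ (Set.range τ)).finrank_add_finrank_orthogonal
  rw [finrank_span_eq_card hτ.linearIndependent] at h4
  have h5 : Module.finrank ℂ U = Fintype.card ι := finrank_span_eq_card hu.linearIndependent
  rw [hdisj, finrank_bot] at h2
  have h6 : Module.finrank ℂ (blockComplement J τ u) = Module.finrank ℂ (T ⊔ U : Submodule ℂ E)ᗮ :=
    rfl
  omega

omit [FiniteDimensional ℂ F] in
-- Parseval's identity; it cancels the block term against the tile sum when the projection formula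
-- is paired with a member.
theorem sum_inner_mul_inner_of_mem_span (hτ : Orthonormal ℂ τ) {x : F}
    (hx : x ∈ Submodule.span ℂ (Set.range τ)) (y : F) :
    ∑ t, inner ℂ x (τ t) * inner ℂ (τ t) y = inner ℂ x y := by
  obtain ⟨c, rfl⟩ := (Submodule.mem_span_range_iff_exists_fun ℂ).1 hx
  simp only [hτ.inner_left_fintype, sum_inner, inner_smul_left]

theorem starProjection_blockComplement (hτ : Orthonormal ℂ τ) (hu : Orthonormal ℂ u)
    (hJ : ∀ i, J.toLinearMap.adjoint (u i) ∈ Submodule.span ℂ (Set.range τ)) (x : E) :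
    (blockComplement J τ u).starProjection x =
      x - J (J.toLinearMap.adjoint x) + ∑ t, inner ℂ (τ t) (J.toLinearMap.adjoint x) • J (τ t)
        - ∑ i, inner ℂ (u i) x • u i := by
  have hadj : ∀ z y, inner ℂ z (J y) = inner ℂ (J.toLinearMap.adjoint z) y := fun z y =>
    (LinearMap.adjoint_inner_left J.toLinearMap y z).symm
  have hadj' : ∀ z y, inner ℂ (J y) z = inner ℂ y (J.toLinearMap.adjoint z) := fun z y =>
    (LinearMap.adjoint_inner_right J.toLinearMap y z).symm
  refine Submodule.eq_starProjection_of_mem_orthogonal ?_ ?_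
  · rw [mem_blockComplement]
    refine ⟨fun y hy => ?_, fun i => ?_⟩
    · have h1 : ∀ t, inner ℂ y (τ t) = 0 := fun t =>
        inner_eq_zero_symm.1 (mem_orthogonal_span_range.1 hy t)
      have h2 := inner_isometry_of_orthogonal hJ hy
      simp only [inner_sub_right, inner_add_right, inner_sum, inner_smul_right, J.inner_map_map,
        h1, h2, mul_zero, Finset.sum_const_zero]
      rw [hadj', sub_self, add_zero, sub_zero]
    · have h1 := sum_inner_mul_inner_of_mem_span hτ (hJ i) (J.toLinearMap.adjoint x)
      rw [inner_sub_right, inner_add_right, inner_sub_right, hu.inner_right_fintype, inner_sum]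
      simp only [inner_smul_right, hadj]
      rw [← h1]
      simp only [mul_comm]
      ring
  · refine Submodule.le_orthogonal_orthogonal _ ?_
    have h1 : x - (x - J (J.toLinearMap.adjoint x) +
        ∑ t, inner ℂ (τ t) (J.toLinearMap.adjoint x) • J (τ t) - ∑ i, inner ℂ (u i) x • u i) =
        J (J.toLinearMap.adjoint x - ∑ t, inner ℂ (τ t) (J.toLinearMap.adjoint x) • τ t) +
          ∑ i, inner ℂ (u i) x • u i := by
      simp only [map_sub, map_sum, map_smul]
      abel
    rw [h1]
    refine Submodule.add_mem_sup ⟨_, ?_, rfl⟩ ?_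
    · rw [SetLike.mem_coe, mem_orthogonal_span_range]
      intro t
      rw [inner_sub_right, hτ.inner_right_fintype, sub_self]
    · exact Submodule.sum_mem _ fun i _ =>
        Submodule.smul_mem _ _ (Submodule.subset_span ⟨i, rfl⟩)

theorem inner_starProjection_blockComplement (hτ : Orthonormal ℂ τ) (hu : Orthonormal ℂ u)
    (hJ : ∀ i, J.toLinearMap.adjoint (u i) ∈ Submodule.span ℂ (Set.range τ)) (x y : E) :
    inner ℂ y ((blockComplement J τ u).starProjection x) =
      inner ℂ y x - inner ℂ (J.toLinearMap.adjoint y) (J.toLinearMap.adjoint x)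
        + ∑ t, inner ℂ (J.toLinearMap.adjoint y) (τ t) * inner ℂ (τ t) (J.toLinearMap.adjoint x)
        - ∑ i, inner ℂ y (u i) * inner ℂ (u i) x := by
  have hadj : ∀ z, inner ℂ y (J z) = inner ℂ (J.toLinearMap.adjoint y) z := fun z =>
    (LinearMap.adjoint_inner_left J.toLinearMap z y).symm
  rw [starProjection_blockComplement hτ hu hJ]
  simp only [inner_sub_right, inner_add_right, inner_sum, inner_smul_right, hadj]
  simp only [mul_comm]

end BlockComplement

/-! ### Entrywise conjugation. -/

section Conjugation

variable {m n : ℕ}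

/-- Entrywise complex conjugation. -/
noncomputable def conjVec (x : EuclideanSpace ℂ (Fin n)) : EuclideanSpace ℂ (Fin n) :=
  WithLp.toLp 2 fun i => starRingEnd ℂ (x i)

@[simp]
theorem conjVec_apply (x : EuclideanSpace ℂ (Fin n)) (i : Fin n) :
    conjVec x i = starRingEnd ℂ (x i) := rfl

@[simp]
theorem conjVec_conjVec (x : EuclideanSpace ℂ (Fin n)) : conjVec (conjVec x) = x := by
  ext i; simp

theorem inner_conjVec_conjVec (x y : EuclideanSpace ℂ (Fin n)) :
    inner ℂ (conjVec x) (conjVec y) = inner ℂ y x := by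
  simp [PiLp.inner_apply, mul_comm]

theorem norm_conjVec (x : EuclideanSpace ℂ (Fin n)) : ‖conjVec x‖ = ‖x‖ := by
  rw [norm_eq_sqrt_re_inner (𝕜 := ℂ), norm_eq_sqrt_re_inner (𝕜 := ℂ), inner_conjVec_conjVec]

/-- The entrywise complex conjugate of an isometry. -/
noncomputable def conjIsometry (W : EuclideanSpace ℂ (Fin m) →ₗᵢ[ℂ] EuclideanSpace ℂ (Fin n)) :
    EuclideanSpace ℂ (Fin m) →ₗᵢ[ℂ] EuclideanSpace ℂ (Fin n) where
  toFun x := conjVec (W (conjVec x))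
  map_add' x y := by
    have h : conjVec (x + y) = conjVec x + conjVec y := by ext i; simp
    rw [h, map_add]
    ext i; simp
  map_smul' c x := by
    have h : conjVec (c • x) = starRingEnd ℂ c • conjVec x := by ext i; simp
    rw [h, map_smul]
    ext i; simp
  norm_map' x := (norm_conjVec _).trans ((W.norm_map _).trans (norm_conjVec x))

theorem conjIsometry_apply (W : EuclideanSpace ℂ (Fin m) →ₗᵢ[ℂ] EuclideanSpace ℂ (Fin n))
    (x : EuclideanSpace ℂ (Fin m)) : conjIsometry W x = conjVec (W (conjVec x)) := rfl

theorem adjoint_conjIsometry (W : EuclideanSpace ℂ (Fin m) →ₗᵢ[ℂ] EuclideanSpace ℂ (Fin n))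
    (y : EuclideanSpace ℂ (Fin n)) :
    (conjIsometry W).toLinearMap.adjoint (conjVec y) = conjVec (W.toLinearMap.adjoint y) := by
  refine ext_inner_left ℂ fun x => ?_
  rw [LinearMap.adjoint_inner_right, LinearIsometry.coe_toLinearMap, conjIsometry_apply,
    inner_conjVec_conjVec, ← conjVec_conjVec x, inner_conjVec_conjVec, conjVec_conjVec,
    LinearMap.adjoint_inner_left, LinearIsometry.coe_toLinearMap]

end Conjugation

/-! ### Tiled families and their partial transpose. -/

/-- Orthonormal families of product vectors `a i ⊗ b i` and, inside the block embedded by `V` and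
`W`, of product vectors `p t ⊗ q t`, such that the compression of every `a i ⊗ b i` to the block is
proportional to some `p t ⊗ q t`. -/
structure IsTiled {k l m n : ℕ} {ι κ : Type*}
    (V : EuclideanSpace ℂ (Fin k) →ₗᵢ[ℂ] EuclideanSpace ℂ (Fin m))
    (W : EuclideanSpace ℂ (Fin l) →ₗᵢ[ℂ] EuclideanSpace ℂ (Fin n))
    (p : κ → EuclideanSpace ℂ (Fin k)) (q : κ → EuclideanSpace ℂ (Fin l))
    (a : ι → EuclideanSpace ℂ (Fin m)) (b : ι → EuclideanSpace ℂ (Fin n)) : Prop where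
  tiles : Orthonormal ℂ fun t => p t ⊗ₜ[ℂ] q t
  states : Orthonormal ℂ fun i => a i ⊗ₜ[ℂ] b i
  compress : ∀ i, ∃ t, ∃ c : ℂ,
    V.toLinearMap.adjoint (a i) ⊗ₜ[ℂ] W.toLinearMap.adjoint (b i) = c • (p t ⊗ₜ[ℂ] q t)

section Tiled

/-- The equality case of Cauchy–Schwarz: for product vectors the norm condition is visibly unchanged
when one factor is conjugated. -/
theorem exists_eq_smul_iff {E : Type*} [NormedAddCommGroup E] [InnerProductSpace ℂ E] {x y : E}
    (hx : ‖x‖ = 1) : (∃ c : ℂ, y = c • x) ↔ ‖inner ℂ x y‖ = ‖y‖ := by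
  constructor
  · rintro ⟨c, rfl⟩
    simp [norm_smul, hx, inner_self_eq_norm_sq_to_K]
  · intro h
    by_cases hy : y = 0
    · exact ⟨0, by simp [hy]⟩
    · have hx0 : x ≠ 0 := by rintro rfl; simp at hx
      have h' : ‖inner ℂ x y‖ = ‖x‖ * ‖y‖ := by rw [h, hx, one_mul]
      obtain ⟨c, -, hc⟩ := (norm_inner_eq_norm_iff hx0 hy).1 h'
      exact ⟨c, hc⟩

theorem orthonormal_tmul_conjVec {ι : Type*} {m n : ℕ} {a : ι → EuclideanSpace ℂ (Fin m)}
    {b : ι → EuclideanSpace ℂ (Fin n)} (h : Orthonormal ℂ fun i => a i ⊗ₜ[ℂ] b i) :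
    Orthonormal ℂ fun i => a i ⊗ₜ[ℂ] conjVec (b i) := by
  refine ⟨fun i => ?_, fun i j hij => ?_⟩
  · have := h.1 i
    rw [TensorProduct.norm_tmul] at this ⊢
    rwa [norm_conjVec]
  · have := h.2 hij
    simp only [TensorProduct.inner_tmul, mul_eq_zero] at this ⊢
    rw [inner_conjVec_conjVec]
    exact this.imp_right inner_eq_zero_symm.1

variable {k l m n : ℕ} {ι κ : Type*}
  {V : EuclideanSpace ℂ (Fin k) →ₗᵢ[ℂ] EuclideanSpace ℂ (Fin m)}
  {W : EuclideanSpace ℂ (Fin l) →ₗᵢ[ℂ] EuclideanSpace ℂ (Fin n)}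
  {p : κ → EuclideanSpace ℂ (Fin k)} {q : κ → EuclideanSpace ℂ (Fin l)}
  {a : ι → EuclideanSpace ℂ (Fin m)} {b : ι → EuclideanSpace ℂ (Fin n)}

/-- Proportionality to a single product tile is what survives conjugation of one factor; mere
membership in the span of the tiles need not. -/
theorem IsTiled.conj (h : IsTiled V W p q a b) :
    IsTiled V (conjIsometry W) p (fun t => conjVec (q t)) a fun i => conjVec (b i) where
  tiles := orthonormal_tmul_conjVec h.tiles
  states := orthonormal_tmul_conjVec h.states
  compress i := by
    obtain ⟨t, ht⟩ := h.compress i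
    refine ⟨t, ?_⟩
    rw [exists_eq_smul_iff (h.tiles.1 t)] at ht
    rw [exists_eq_smul_iff ((orthonormal_tmul_conjVec h.tiles).1 t), adjoint_conjIsometry]
    rw [TensorProduct.inner_tmul, TensorProduct.norm_tmul, norm_mul] at ht ⊢
    rw [inner_conjVec_conjVec, norm_conjVec, norm_inner_symm (W.toLinearMap.adjoint (b i))]
    exact ht

theorem adjoint_mapIsometry_tmul (e : EuclideanSpace ℂ (Fin m)) (f : EuclideanSpace ℂ (Fin n)) :
    (TensorProduct.mapIsometry V W).toLinearMap.adjoint (e ⊗ₜ[ℂ] f) =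
      V.toLinearMap.adjoint e ⊗ₜ[ℂ] W.toLinearMap.adjoint f := by
  rw [TensorProduct.toLinearMap_mapIsometry, TensorProduct.adjoint_map]
  rfl

theorem IsTiled.adjoint_mem_span (h : IsTiled V W p q a b) (i : ι) :
    (TensorProduct.mapIsometry V W).toLinearMap.adjoint (a i ⊗ₜ[ℂ] b i) ∈
      Submodule.span ℂ (Set.range fun t => p t ⊗ₜ[ℂ] q t) := by
  obtain ⟨t, c, hc⟩ := h.compress i
  rw [adjoint_mapIsometry_tmul, hc]
  exact Submodule.smul_mem _ _ (Submodule.subset_span ⟨t, rfl⟩)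

variable [Fintype ι] [Fintype κ]

theorem IsTiled.inner_starProjection (h : IsTiled V W p q a b)
    (e e' : EuclideanSpace ℂ (Fin m)) (f f' : EuclideanSpace ℂ (Fin n)) :
    inner ℂ (e ⊗ₜ[ℂ] f) ((blockComplement (TensorProduct.mapIsometry V W)
      (fun t => p t ⊗ₜ[ℂ] q t) (fun i => a i ⊗ₜ[ℂ] b i)).starProjection (e' ⊗ₜ[ℂ] f')) =
    inner ℂ e e' * inner ℂ f f'
      - inner ℂ (V.toLinearMap.adjoint e) (V.toLinearMap.adjoint e') *
        inner ℂ (W.toLinearMap.adjoint f) (W.toLinearMap.adjoint f')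
      + ∑ t, inner ℂ (V.toLinearMap.adjoint e) (p t) * inner ℂ (W.toLinearMap.adjoint f) (q t) *
        (inner ℂ (p t) (V.toLinearMap.adjoint e') * inner ℂ (q t) (W.toLinearMap.adjoint f'))
      - ∑ i, inner ℂ e (a i) * inner ℂ f (b i) * (inner ℂ (a i) e' * inner ℂ (b i) f') := by
  rw [inner_starProjection_blockComplement h.tiles h.states h.adjoint_mem_span]
  simp only [adjoint_mapIsometry_tmul, TensorProduct.inner_tmul]

/-- Every term of the projection formula is a form in `e, e'` times a form in `f, f'`, and
conjugation swaps `f` and `f'`. -/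
theorem IsTiled.inner_starProjection_conj (h : IsTiled V W p q a b)
    (e e' : EuclideanSpace ℂ (Fin m)) (f f' : EuclideanSpace ℂ (Fin n)) :
    inner ℂ (e ⊗ₜ[ℂ] conjVec f) ((blockComplement (TensorProduct.mapIsometry V (conjIsometry W))
      (fun t => p t ⊗ₜ[ℂ] conjVec (q t))
      (fun i => a i ⊗ₜ[ℂ] conjVec (b i))).starProjection (e' ⊗ₜ[ℂ] conjVec f')) =
    inner ℂ (e ⊗ₜ[ℂ] f') ((blockComplement (TensorProduct.mapIsometry V W)
      (fun t => p t ⊗ₜ[ℂ] q t) (fun i => a i ⊗ₜ[ℂ] b i)).starProjection (e' ⊗ₜ[ℂ] f)) := by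
  rw [h.inner_starProjection, h.conj.inner_starProjection]
  simp only [adjoint_conjIsometry, inner_conjVec_conjVec]
  exact congrArg₂ (· - ·) (congrArg₂ (· + ·) (by ring) (Finset.sum_congr rfl fun _ _ => by ring))
    (Finset.sum_congr rfl fun _ _ => by ring)

/-- Cauchy–Schwarz for the projection onto the conjugated space `R'`, which is the partial
transpose. -/
theorem IsTiled.norm_inner_le (h : IsTiled V W p q a b)
    {R : Submodule ℂ (EuclideanSpace ℂ (Fin m) ⊗[ℂ] EuclideanSpace ℂ (Fin n))}
    (hR : R = blockComplement (TensorProduct.mapIsometry V W)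
        (fun t => p t ⊗ₜ[ℂ] q t) (fun i => a i ⊗ₜ[ℂ] b i))
    (e e' : EuclideanSpace ℂ (Fin m)) (f f' : EuclideanSpace ℂ (Fin n)) :
    ‖inner ℂ (R.orthogonalProjectionOnto (e ⊗ₜ[ℂ] f'))
      (R.orthogonalProjectionOnto (e' ⊗ₜ[ℂ] f))‖ ≤
      ‖R.orthogonalProjectionOnto (e ⊗ₜ[ℂ] f)‖ *
        ‖R.orthogonalProjectionOnto (e' ⊗ₜ[ℂ] f')‖ := by
  have key := h.inner_starProjection_conj
  simp only [← hR] at key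
  set R' := blockComplement (TensorProduct.mapIsometry V (conjIsometry W))
        (fun t => p t ⊗ₜ[ℂ] conjVec (q t)) (fun i => a i ⊗ₜ[ℂ] conjVec (b i))
  have hproj : ∀ (U : Submodule ℂ (EuclideanSpace ℂ (Fin m) ⊗[ℂ] EuclideanSpace ℂ (Fin n))) x y,
      inner ℂ (U.orthogonalProjectionOnto x) (U.orthogonalProjectionOnto y) =
        inner ℂ x (U.starProjection y) := by
    intro U x y
    rw [Submodule.inner_orthogonalProjectionOnto_eq_of_mem_right]
    rfl
  have hnorm : ∀ e f, ‖R.orthogonalProjectionOnto (e ⊗ₜ[ℂ] f)‖ =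
      ‖R'.orthogonalProjectionOnto (e ⊗ₜ[ℂ] conjVec f)‖ := by
    intro e f
    rw [norm_eq_sqrt_re_inner (𝕜 := ℂ), norm_eq_sqrt_re_inner (𝕜 := ℂ), hproj, hproj, key]
  rw [hproj, ← key, ← hproj, hnorm, hnorm]
  exact norm_inner_le_norm (𝕜 := ℂ) (R'.orthogonalProjectionOnto (e ⊗ₜ[ℂ] conjVec f))
    (R'.orthogonalProjectionOnto (e' ⊗ₜ[ℂ] conjVec f'))

/-- An orthonormal family of product states that is tiled by an orthonormal family of product
states of a block and falls short of the count `dim - dim block + #tiles` by one, two or three is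
extendible. -/
theorem IsTiled.exists_isProductState (h : IsTiled V W p q a b)
    (hlt : k * l + Fintype.card ι < m * n + Fintype.card κ)
    (hle : m * n + Fintype.card κ ≤ k * l + Fintype.card ι + 3) :
    ∃ w, IsProductState w ∧ ∀ i, inner ℂ (a i ⊗ₜ[ℂ] b i) w = 0 := by
  have hdim := finrank_blockComplement h.tiles h.states h.adjoint_mem_span
  simp only [Module.finrank_tensorProduct, finrank_euclideanSpace, Fintype.card_fin] at hdim
  have hnt : Nontrivial (blockComplement (TensorProduct.mapIsometry V W)
        (fun t => p t ⊗ₜ[ℂ] q t) (fun i => a i ⊗ₜ[ℂ] b i)) :=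
    Module.nontrivial_of_finrank_pos (R := ℂ) (by omega)
  obtain ⟨w, hw, hprod⟩ := exists_isProductState_mem _ (by omega) (h.norm_inner_le rfl)
  exact ⟨w, hprod, (mem_blockComplement.1 hw).2⟩

end Tiled

/-! ### The Tiles states and the count in dimension 5 × 5. -/

theorem orthonormal_normalize_tmul {ι : Type*} {m n : ℕ} {a : ι → EuclideanSpace ℂ (Fin m)}
    {b : ι → EuclideanSpace ℂ (Fin n)} (ha : ∀ i, a i ≠ 0) (hb : ∀ i, b i ≠ 0)
    (h : Pairwise fun i j => inner ℂ (a i ⊗ₜ[ℂ] b i) (a j ⊗ₜ[ℂ] b j) = 0) :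
    Orthonormal ℂ fun i => ((‖a i‖⁻¹ : ℂ) • a i) ⊗ₜ[ℂ] ((‖b i‖⁻¹ : ℂ) • b i) := by
  refine ⟨fun i => ?_, fun i j hij => ?_⟩
  · rw [TensorProduct.norm_tmul]
    simp [norm_smul, ha, hb]
  · have := h hij
    simp only [TensorProduct.inner_tmul, inner_smul_left, inner_smul_right] at this ⊢
    linear_combination (starRingEnd ℂ (‖a i‖⁻¹ : ℂ)) * (‖a j‖⁻¹ : ℂ) *
      (starRingEnd ℂ (‖b i‖⁻¹ : ℂ)) * (‖b j‖⁻¹ : ℂ) * this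

/-- The left factors of the Tiles states. -/
noncomputable def tileLeft : Fin 5 → EuclideanSpace ℂ (Fin 3) :=
  ![ket 0, ket 2, ket 0 - ket 1, ket 1 - ket 2, ket 0 + ket 1 + ket 2]

/-- The right factors of the Tiles states. -/
noncomputable def tileRight : Fin 5 → EuclideanSpace ℂ (Fin 3) :=
  ![ket 0 - ket 1, ket 1 - ket 2, ket 2, ket 0, ket 0 + ket 1 + ket 2]

theorem tileLeft_ne_zero (t : Fin 5) : tileLeft t ≠ 0 := by
  intro h
  have h' : ∀ i, tileLeft t i = 0 := fun i => by rw [h]; rfl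
  have h0 := h' 0
  have h1 := h' 1
  have h2 := h' 2
  clear h h'
  fin_cases t <;> simp [tileLeft, ket] at h0 h1 h2

theorem tileRight_ne_zero (t : Fin 5) : tileRight t ≠ 0 := by
  intro h
  have h' : ∀ i, tileRight t i = 0 := fun i => by rw [h]; rfl
  have h0 := h' 0
  have h1 := h' 1
  have h2 := h' 2
  clear h h'
  fin_cases t <;> simp [tileRight, ket] at h0 h1 h2

theorem pairwise_inner_tiles : Pairwise fun s t =>
    inner ℂ (tileLeft s ⊗ₜ[ℂ] tileRight s) (tileLeft t ⊗ₜ[ℂ] tileRight t) = 0 := by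
  intro s t hst
  simp only [TensorProduct.inner_tmul, PiLp.inner_apply, Fin.sum_univ_three]
  fin_cases s <;> fin_cases t <;> simp [tileLeft, tileRight, ket] at hst ⊢

theorem mem_tilesUPB_iff {x : EuclideanSpace ℂ (Fin 3) ⊗[ℂ] EuclideanSpace ℂ (Fin 3)} :
    x ∈ tilesUPB ↔ ∃ t, x = tileLeft t ⊗ₜ[ℂ] tileRight t := by
  simp [tilesUPB, Fin.exists_fin_succ, tileLeft, tileRight]

theorem IsUPB.card_lt_or_gt_of_preservesTiles
    {S : Set (EuclideanSpace ℂ (Fin 5) ⊗[ℂ] EuclideanSpace ℂ (Fin 5))} (hS : IsUPB S)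
    (htiles : PreservesTiles S) [Fintype S] : Fintype.card S < 18 ∨ 20 < Fintype.card S := by
  by_contra! hcard
  obtain ⟨V, W, hVW⟩ := htiles
  choose a b ha hb hab using fun x : S => hS.isProductState x x.2
  have horth : Pairwise fun x y => inner ℂ (a x ⊗ₜ[ℂ] b x) (a y ⊗ₜ[ℂ] b y) = 0 := by
    intro x y hxy
    simp only [← hab]
    exact hS.orthogonal x.2 y.2 fun h => hxy (Subtype.ext h)
  have htiled : IsTiled V W (fun t => (‖tileLeft t‖⁻¹ : ℂ) • tileLeft t)
      (fun t => (‖tileRight t‖⁻¹ : ℂ) • tileRight t)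
      (fun x => (‖a x‖⁻¹ : ℂ) • a x) (fun x => (‖b x‖⁻¹ : ℂ) • b x) := by
    refine ⟨orthonormal_normalize_tmul tileLeft_ne_zero tileRight_ne_zero pairwise_inner_tiles,
      orthonormal_normalize_tmul ha hb horth, fun x => ?_⟩
    obtain ⟨c, y, hy, hc⟩ := hVW x x.2
    obtain ⟨t, rfl⟩ := mem_tilesUPB_iff.1 hy
    have hc' : V.toLinearMap.adjoint (a x) ⊗ₜ[ℂ] W.toLinearMap.adjoint (b x) =
        c • (tileLeft t ⊗ₜ[ℂ] tileRight t) := by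
      rw [← hc, hab x]; rfl
    refine ⟨t, (‖a x‖⁻¹ : ℂ) * (‖b x‖⁻¹ : ℂ) * c * ‖tileLeft t‖ * ‖tileRight t‖, ?_⟩
    have h1 : (‖tileLeft t‖ : ℂ) ≠ 0 := by simp [tileLeft_ne_zero]
    have h2 : (‖tileRight t‖ : ℂ) ≠ 0 := by simp [tileRight_ne_zero]
    simp only [map_smul, TensorProduct.smul_tmul_smul, hc', smul_smul]
    congr 1
    field_simp
  -- The threshold is 25 - 9 + 5 = 21, so 18 to 20 members fall short by one to three.
  obtain ⟨w, hw, hwo⟩ := htiled.exists_isProductState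
    (by simp only [Fintype.card_fin]; omega) (by simp only [Fintype.card_fin]; omega)
  refine hS.unextendible w ?_ hw
  have hrange : S = Set.range fun x : S => (x : EuclideanSpace ℂ (Fin 5) ⊗[ℂ] _) :=
    Subtype.range_coe.symm
  rw [hrange, mem_orthogonal_span_range]
  intro x
  have h := hwo x
  rw [TensorProduct.smul_tmul_smul] at h
  rw [hab x]
  refine (mul_eq_zero.1 ((inner_smul_left (a x ⊗ₜ[ℂ] b x) w _).symm.trans h)).resolve_left ?_
  simp [ha, hb]

theorem mainTheorem6
    (S : Set (EuclideanSpace ℂ (Fin 5) ⊗[ℂ] EuclideanSpace ℂ (Fin 5)))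
    (hS : IsUPB S) (htiles : PreservesTiles S) :
    S.ncard ≠ 18 ∧ S.ncard ≠ 19 ∧ S.ncard ≠ 20 := by
  by_cases hfin : S.Finite
  · have := hfin.fintype
    have h := hS.card_lt_or_gt_of_preservesTiles htiles
    rw [← Nat.card_eq_fintype_card, Nat.card_coe_set_eq] at h
    omega
  -- An infinite set has `ncard` equal to 0.
  · rw [Set.Infinite.ncard hfin]
    omega
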